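/- Let $c\ge 2$, let $G$ be a finite digraph (no parallel arcs) with an arbitrary arc coloring $\phi:A(G)\to\{1,\dots,c\}$ and nonnegative arc weights $\omega:A(G)\to\mathbb{R}_{\ge 0}$, and let $s,t\in V(G)$, where $s=t$ is allowed. A properly colored (PC) fixed end-vertex $s$-$t$ trail is a directed walk $v_1v_2\dots v_p$ in $G$ with $p\ge 2$, $v_1=s$, $v_p=t$, in which no arc is repeated and $\phi(v_iv_{i+1})\ne\phi(v_{i+1}v_{i+2})$ for all $i$ with $1\le i\le p-2$ (if $s=t$, the last and the first arc may have the same color). Its weight is $\sum_{i=1}^{p-1}\omega(v_iv_{i+1})$. There is an algorithm, polynomial in $|V(G)|+|A(G)|$ (the same algorithm and the same polynomial for all $c$, $G$, $\phi$, $\omega$, $s$, $t$), that decides whether $G$ has a PC fixed end-vertex $s$-$t$ trail and, if one exists, outputs one of minimum weight. Here time is counted on a random access machine in which each elementary operation on integers (copy, addition, truncated subtraction, comparison, indirect addressing) and each copy, addition or comparison of weights takes one step. -/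

import Mathlib

open scoped NNReal

/-! ### A random access machine with weights

The machine has natural-number registers and arrays (for indices, vertices, colours) and,
separately, registers and arrays that hold nonnegative real weights. Weights can only be copied,
added and compared; indices can only be copied, added, subtracted (truncated) and compared.
There is no multiplication and no conversion between weights and natural numbers. Every
elementary operation and every evaluation of a test takes one step. -/

namespace RAM

/-- The memory of the machine: registers `reg x`, arrays `arr a` with cells `arr a i`, weight
registers `wreg x` and weight arrays `warr a` with cells `warr a i`. -/
structure State where
  reg : ℕ → ℕ
  arr : ℕ → ℕ → ℕ
  wreg : ℕ → ℝ≥0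
  warr : ℕ → ℕ → ℝ≥0

/-- Elementary operations. Register and array names, and the constant of `const`, are fixed in the
program text; an array is accessed at the index held by a register. -/
inductive Op
  | skip
  | const (x k : ℕ)
  | move (x y : ℕ)
  | add (x y z : ℕ)
  | sub (x y z : ℕ)
  | read (x a i : ℕ)
  | write (a i x : ℕ)
  | wzero (x : ℕ)
  | wmove (x y : ℕ)
  | wadd (x y z : ℕ)
  | wread (x a i : ℕ)
  | wwrite (a i x : ℕ)

/-- The effect of an elementary operation. -/
noncomputable def Op.exec (σ : State) : Op → State
  | .skip => σ
  | .const x k => { σ with reg := Function.update σ.reg x k }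
  | .move x y => { σ with reg := Function.update σ.reg x (σ.reg y) }
  | .add x y z => { σ with reg := Function.update σ.reg x (σ.reg y + σ.reg z) }
  | .sub x y z => { σ with reg := Function.update σ.reg x (σ.reg y - σ.reg z) }
  | .read x a i => { σ with reg := Function.update σ.reg x (σ.arr a (σ.reg i)) }
  | .write a i x =>
      { σ with arr := Function.update σ.arr a (Function.update (σ.arr a) (σ.reg i) (σ.reg x)) }
  | .wzero x => { σ with wreg := Function.update σ.wreg x 0 }
  | .wmove x y => { σ with wreg := Function.update σ.wreg x (σ.wreg y) }
  | .wadd x y z => { σ with wreg := Function.update σ.wreg x (σ.wreg y + σ.wreg z) }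
  | .wread x a i => { σ with wreg := Function.update σ.wreg x (σ.warr a (σ.reg i)) }
  | .wwrite a i x =>
      { σ with
        warr := Function.update σ.warr a (Function.update (σ.warr a) (σ.reg i) (σ.wreg x)) }

/-- Tests: comparison of two registers or of two weight registers. -/
inductive Test
  | eq (x y : ℕ)
  | lt (x y : ℕ)
  | wlt (x y : ℕ)

/-- The outcome of a test. -/
def Test.Holds (σ : State) : Test → Prop
  | .eq x y => σ.reg x = σ.reg y
  | .lt x y => σ.reg x < σ.reg y
  | .wlt x y => σ.wreg x < σ.wreg y

/-- Programs. -/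
inductive Prog
  | op (o : Op)
  | seq (P Q : Prog)
  | ite (b : Test) (P Q : Prog)
  | loop (b : Test) (P : Prog)

/-- `Run P σ k τ`: started in `σ`, the program `P` halts after exactly `k` steps in `τ`.
`loop b P` is the loop "while `b` do `P`". -/
inductive Run : Prog → State → ℕ → State → Prop
  | op (o : Op) (σ : State) : Run (.op o) σ 1 (o.exec σ)
  | seq {P Q : Prog} {σ τ υ : State} {j k : ℕ} :
      Run P σ j τ → Run Q τ k υ → Run (.seq P Q) σ (j + k) υ
  | ite_true {b : Test} {P Q : Prog} {σ τ : State} {k : ℕ} :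
      b.Holds σ → Run P σ k τ → Run (.ite b P Q) σ (k + 1) τ
  | ite_false {b : Test} {P Q : Prog} {σ τ : State} {k : ℕ} :
      ¬ b.Holds σ → Run Q σ k τ → Run (.ite b P Q) σ (k + 1) τ
  | loop_true {b : Test} {P : Prog} {σ τ υ : State} {j k : ℕ} :
      b.Holds σ → Run P σ j τ → Run (.loop b P) τ k υ → Run (.loop b P) σ (j + k + 1) υ
  | loop_false {b : Test} {P : Prog} {σ : State} :
      ¬ b.Holds σ → Run (.loop b P) σ 1 σ

end RAM

/-! ### Arc-coloured weighted digraphs and properly coloured trails -/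

namespace Digraph

variable {V : Type*} (G : Digraph V)

/-- The arcs of a digraph. -/
abbrev Arc : Type _ := {p : V × V // G.Adj p.1 p.2}

end Digraph

/-- A digraph with arc colours `1, …, c` (represented by `Fin c`) and nonnegative real arc
weights. -/
structure ColoredDigraph (V : Type*) (c : ℕ) extends Digraph V where
  color : toDigraph.Arc → Fin c
  weight : toDigraph.Arc → ℝ≥0

namespace ColoredDigraph

variable {V : Type*} {c : ℕ} (G : ColoredDigraph V c)

/-- The arcs of an arc-coloured digraph. -/
abbrev Arc : Type _ := G.toDigraph.Arc

variable {G}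

/-- The vertex in which an arc starts. -/
def Arc.tail (e : G.Arc) : V := e.1.1

/-- The vertex in which an arc ends. -/
def Arc.head (e : G.Arc) : V := e.1.2

variable (G)

/-- The list `T` of consecutive arcs is a trail from `s` to `t`: it has at least one arc, each arc
starts where the preceding one ends, and no arc is repeated (vertices may be, and `s = t` is
allowed). -/
structure IsTrail (s t : V) (T : List G.Arc) : Prop where
  ne_nil : T ≠ []
  start : ∀ e ∈ T.head?, e.tail = s
  finish : ∀ e ∈ T.getLast?, e.head = t
  chain : T.IsChain fun e f => e.head = f.tail
  nodup : T.Nodup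

/-- A properly coloured fixed end-vertex `s`-`t` trail: any two consecutive arcs have different
colours; the last and the first arc may have the same colour, even if `s = t`. -/
structure IsPCFEVTrail (s t : V) (T : List G.Arc) : Prop extends G.IsTrail s t T where
  proper : T.IsChain fun e f => G.color e ≠ G.color f

/-- The total weight of the arcs of a trail. -/
noncomputable def trailWeight (T : List G.Arc) : ℝ≥0 := (T.map G.weight).sum

/-- `T` is a properly coloured fixed end-vertex `s`-`t` trail of minimum weight. -/
def IsMinPCFEVTrail (s t : V) (T : List G.Arc) : Prop :=
  G.IsPCFEVTrail s t T ∧ ∀ T', G.IsPCFEVTrail s t T' → G.trailWeight T ≤ G.trailWeight T'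

end ColoredDigraph

/-! ### Input and output conventions -/

namespace ColoredDigraph

variable {n m c : ℕ} (G : ColoredDigraph (Fin n) c) (arc : Fin m ≃ G.Arc)

/-- The input `(G, s, t)`, where the arcs of `G` are listed as `arc 0, …, arc (m - 1)` in an
arbitrary order: registers `0, …, 4` hold `n`, `m`, `c`, `s`, `t`; cell `i < m` of the arrays
`0`, `1`, `2` and of the weight array `0` holds the tail, the head, the colour and the weight of
`arc i`. All the rest of the memory is zero. -/
noncomputable def inputState (s t : Fin n) : RAM.State where
  reg x := match x with
    | 0 => n
    | 1 => m
    | 2 => c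
    | 3 => s
    | 4 => t
    | _ => 0
  arr a i :=
    if h : i < m then
      match a with
      | 0 => (arc ⟨i, h⟩).tail
      | 1 => (arc ⟨i, h⟩).head
      | 2 => G.color (arc ⟨i, h⟩)
      | _ => 0
    else 0
  wreg _ := 0
  warr a i :=
    if h : i < m then
      match a with
      | 0 => G.weight (arc ⟨i, h⟩)
      | _ => 0
    else 0

/-- The final memory `σ` describes the list of arcs `T`: register `1` holds the number of arcs
of `T`, and array `0` holds the positions of these arcs, in order, in the input list of arcs. -/
def Outputs (σ : RAM.State) (T : List G.Arc) : Prop :=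
  σ.reg 1 = T.length ∧ ∀ (i : ℕ) (h : i < T.length), σ.arr 0 i = arc.symm T[i]

end ColoredDigraph

/-! Take the arcs of the digraph as nodes and join x to y when the head of x is the tail of y and
the colors differ. A trail may repeat vertices but not arcs, so properly colored trails are the
paths without repeated nodes in this line digraph. Two extra nodes of weight 0 fix the ends: an arc
`m + 1` into s and an arc `m` out of t, both in the color c, which no input arc has. They impose no
color condition on the first and last arc, and since they share their color they are not joined to
each other, which excludes the empty trail even when s = t.

It remains to find a cheapest path from `m + 1` to `m`. As weights are nonnegative, Dijkstra's
algorithm yields a path without repetitions that is at most as heavy as any walk (`Settled.step`).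
Every trail gives such a walk (`IsPCFEVTrail.walk`), and the path found is a trail
(`isPCFEVTrail_of_isShortest`). The search runs backwards from `m`, so that the successor pointers
list the arcs in output order. Each of the m + 2 rounds scans all pairs of nodes, so the time is
cubic in m. -/

namespace RAM

/-! ### Total correctness with a time bound -/

/-- Started in `σ`, the program `P` halts within `B` steps in a state satisfying `Q`. -/
def Ensures (P : Prog) (B : ℕ) (σ : State) (Q : State → Prop) : Prop :=
  ∃ k τ, Run P σ k τ ∧ k ≤ B ∧ Q τ

theorem Ensures.mono {P : Prog} {B : ℕ} {σ : State} {Q Q' : State → Prop}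
    (h : Ensures P B σ Q) (hQ : ∀ τ, Q τ → Q' τ) : Ensures P B σ Q' := by
  obtain ⟨k, τ, hr, hk, hq⟩ := h
  exact ⟨k, τ, hr, hk, hQ τ hq⟩

theorem Ensures.seq {P P' : Prog} {B B' : ℕ} {σ : State} {Q Q' : State → Prop}
    (h : Ensures P B σ Q) (h' : ∀ τ, Q τ → Ensures P' B' τ Q') :
    Ensures (.seq P P') (B + B') σ Q' := by
  obtain ⟨k, τ, hr, hk, hq⟩ := h
  obtain ⟨k', τ', hr', hk', hq'⟩ := h' τ hq
  exact ⟨k + k', τ', .seq hr hr', by omega, hq'⟩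

theorem Ensures.ite {b : Test} {P P' : Prog} {B : ℕ} {σ : State} {Q : State → Prop}
    (h : b.Holds σ → Ensures P B σ Q) (h' : ¬ b.Holds σ → Ensures P' B σ Q) :
    Ensures (.ite b P P') (B + 1) σ Q := by
  by_cases hb : b.Holds σ
  · obtain ⟨k, τ, hr, hk, hq⟩ := h hb
    exact ⟨k + 1, τ, .ite_true hb hr, by omega, hq⟩
  · obtain ⟨k, τ, hr, hk, hq⟩ := h' hb
    exact ⟨k + 1, τ, .ite_false hb hr, by omega, hq⟩

/-- A loop whose test is equivalent to `i < N`, where `i` is incremented by the body. -/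
theorem Ensures.loop {b : Test} {P : Prog} {B N : ℕ} (I : ℕ → State → Prop)
    (hb : ∀ i σ, I i σ → (b.Holds σ ↔ i < N))
    (hP : ∀ i σ, i < N → I i σ → Ensures P B σ (I (i + 1))) {σ : State} (h : I 0 σ) :
    Ensures (.loop b P) (N * (B + 1) + 1) σ (I N) := by
  suffices H : ∀ j i σ, i + j = N → I i σ → Ensures (.loop b P) (j * (B + 1) + 1) σ (I N) from
    H N 0 σ (by omega) h
  intro j
  induction j with
  | zero =>
    intro i σ hi h
    obtain rfl : i = N := by omega
    exact ⟨1, σ, .loop_false (by simp [hb _ _ h]), by omega, h⟩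
  | succ j ih =>
    intro i σ hi h
    obtain ⟨k, τ, hr, hk, hq⟩ := hP i σ (by omega) h
    obtain ⟨k', τ', hr', hk', hq'⟩ := ih (i + 1) τ (by omega) hq
    refine ⟨k + k' + 1, τ', .loop_true ((hb _ _ h).2 (by omega)) hr hr', ?_, hq'⟩
    rw [Nat.succ_mul]
    omega

/-- An upper bound for the running time of a loop-free program. -/
def Prog.time : Prog → ℕ
  | .op _ => 1
  | .seq P Q => P.time + Q.time
  | .ite _ P Q => P.time + Q.time + 1
  | .loop _ _ => 0

/-- The weakest precondition of a loop-free program. -/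
def wp : Prog → (State → Prop) → State → Prop
  | .op o, Q, σ => Q (o.exec σ)
  | .seq P P', Q, σ => wp P (wp P' Q) σ
  | .ite b P P', Q, σ => (b.Holds σ → wp P Q σ) ∧ (¬ b.Holds σ → wp P' Q σ)
  | .loop _ _, _, _ => False

theorem ensures_of_wp {P : Prog} {Q : State → Prop} {σ : State} (h : wp P Q σ) :
    Ensures P P.time σ Q := by
  induction P generalizing Q σ with
  | op o => exact ⟨1, _, .op o σ, le_rfl, h⟩
  | seq P P' ih ih' => exact (ih h).seq fun τ hτ => ih' hτ
  | ite b P P' ih ih' =>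
    obtain ⟨h₁, h₂⟩ := h
    by_cases hb : b.Holds σ
    · obtain ⟨k, τ, hr, hk, hq⟩ := ih (h₁ hb)
      exact ⟨k + 1, τ, .ite_true hb hr, by simp only [Prog.time]; omega, hq⟩
    · obtain ⟨k, τ, hr, hk, hq⟩ := ih' (h₂ hb)
      exact ⟨k + 1, τ, .ite_false hb hr, by simp only [Prog.time]; omega, hq⟩
  -- The precondition of a loop is `False`, so the value 0 of `Prog.time` on loops is never relied
  -- on.
  | loop b P => exact h.elim

end RAM

/-! ### Shortest paths to a target in a digraph with weighted nodes -/

namespace ShortestPath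

/-- There is a walk of weight `W` from `x` to `z`; the weight of `z` is not counted. -/
inductive Walk (R : ℕ → ℕ → Prop) (w : ℕ → ℝ≥0) (z : ℕ) : ℕ → ℝ≥0 → Prop
  | nil : Walk R w z z 0
  | cons {x y : ℕ} {W : ℝ≥0} : R x y → Walk R w z y W → Walk R w z x (w x + W)

/-- `R x y` is an arc that enters the set of nodes marked by `1` in `D`. -/
def Cand (R : ℕ → ℕ → Prop) (D : ℕ → ℕ) (x y : ℕ) : Prop := D x ≠ 1 ∧ D y = 1 ∧ R x y

/-- The invariant of Dijkstra's algorithm: `D` marks the settled nodes, `d` holds their distances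
to `z`, and `nx` their successors on a shortest path to `z`. -/
structure Settled (R : ℕ → ℕ → Prop) (w : ℕ → ℝ≥0) (z : ℕ) (D : ℕ → ℕ) (d : ℕ → ℝ≥0)
    (nx : ℕ → ℕ) : Prop where
  target : D z = 1
  path : ∀ x, D x = 1 → ∃ p : List ℕ, (x :: p).Nodup ∧
    (x :: p).IsChain (fun a b => R a b ∧ nx a = b) ∧ (x :: p).getLast? = some z ∧
    (∀ y ∈ x :: p, D y = 1) ∧ d x = ((x :: p).map w).sum
  opt : ∀ x W, D x = 1 → Walk R w z x W → d x ≤ W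

variable {R : ℕ → ℕ → Prop} {w : ℕ → ℝ≥0} {z : ℕ} {D : ℕ → ℕ} {d : ℕ → ℝ≥0} {nx : ℕ → ℕ}

/-- A settled path counts the weight of z while `Walk` does not; `w z = 0` reconciles the two. -/
theorem settled_init (hw : w z = 0) (hz : D z = 1) (hD : ∀ x, D x = 1 → x = z) (hd : d z = 0) :
    Settled R w z D d nx where
  target := hz
  path x hx := by
    obtain rfl := hD x hx
    exact ⟨[], by simp [hw, hd, hz]⟩
  opt x W hx _ := by
    obtain rfl := hD x hx
    simp [hd]

/-- A walk from an unsettled node enters the settled nodes through some arc. -/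
theorem Settled.exists_cand (h : Settled R w z D d nx) {x : ℕ} {W : ℝ≥0} (hW : Walk R w z x W)
    (hx : D x ≠ 1) : ∃ a b, Cand R D a b ∧ w a + d b ≤ W := by
  induction hW with
  | nil => exact absurd h.target hx
  | @cons x y W hxy hW ih =>
    by_cases hy : D y = 1
    · exact ⟨x, y, ⟨hx, hy, hxy⟩, by gcongr; exact h.opt y W hy hW⟩
    · obtain ⟨a, b, hab, hle⟩ := ih hy
      -- Nonnegativity of the weights: dropping the initial node does not increase the cost.
      exact ⟨a, b, hab, hle.trans le_add_self⟩

theorem Settled.step (h : Settled R w z D d nx) {e f : ℕ} (hc : Cand R D e f)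
    (hmin : ∀ a b, Cand R D a b → w e + d f ≤ w a + d b) :
    Settled R w z (Function.update D e 1) (Function.update d e (w e + d f))
      (Function.update nx e f) := by
  obtain ⟨he, hf, hR⟩ := hc
  have hne : ∀ x, D x = 1 → x ≠ e := by rintro x hx rfl; exact he hx
  -- Old paths stay among settled nodes and so avoid e; redirecting the pointer of e does not affect
  -- them.
  have key : ∀ x, D x = 1 → ∃ p : List ℕ, (x :: p).Nodup ∧
      (x :: p).IsChain (fun a b => R a b ∧ Function.update nx e f a = b) ∧
      (x :: p).getLast? = some z ∧ (∀ y ∈ x :: p, D y = 1) ∧ d x = ((x :: p).map w).sum := by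
    intro x hx
    obtain ⟨p, h₁, h₂, h₃, h₄, h₅⟩ := h.path x hx
    refine ⟨p, h₁, ?_, h₃, h₄, h₅⟩
    rw [List.isChain_iff_getElem] at h₂ ⊢
    intro i hi
    rw [Function.update_of_ne (hne _ (h₄ _ (List.getElem_mem _)))]
    exact h₂ i hi
  have hup : ∀ y, D y = 1 → Function.update D e 1 y = 1 := by
    intro y hy
    rw [Function.update_of_ne (hne y hy), hy]
  refine ⟨hup z h.target, fun x hx => ?_, fun x W hx hW => ?_⟩
  · by_cases hxe : x = e
    · subst hxe
      obtain ⟨p, h₁, h₂, h₃, h₄, h₅⟩ := key f hf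
      refine ⟨f :: p, ?_, ?_, ?_, ?_, ?_⟩
      · exact List.nodup_cons.2 ⟨fun hm => he (h₄ _ hm), h₁⟩
      · exact List.isChain_cons_cons.2 ⟨⟨hR, by simp⟩, h₂⟩
      · simpa using h₃
      · intro y hy
        rcases List.mem_cons.1 hy with rfl | hy
        · simp
        · exact hup y (h₄ y hy)
      · rw [List.map_cons, List.sum_cons, Function.update_self, h₅]
    · rw [Function.update_of_ne hxe] at hx
      obtain ⟨p, h₁, h₂, h₃, h₄, h₅⟩ := key x hx
      exact ⟨p, h₁, h₂, h₃, fun y hy => hup y (h₄ y hy), by rwa [Function.update_of_ne hxe]⟩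
  · by_cases hxe : x = e
    · subst hxe
      rw [Function.update_self]
      -- Any walk from e enters the settled set through a candidate, which costs at least as much as
      -- (e, f).
      obtain ⟨a, b, hab, hle⟩ := h.exists_cand hW he
      exact (hmin a b hab).trans hle
    · rw [Function.update_of_ne hxe] at hx ⊢
      exact h.opt x W hx hW

/-- No arc enters the settled nodes, or more than `r` nodes below `N` are settled. -/
def Progress (R : ℕ → ℕ → Prop) (N : ℕ) (D : ℕ → ℕ) (r : ℕ) : Prop :=
  (∀ a b, ¬ Cand R D a b) ∨ r < ((Finset.range N).filter fun x => D x = 1).card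

/-- Only N nodes lie below N, so after N rounds the counting alternative is impossible. -/
theorem Progress.not_cand {N : ℕ} (h : Progress R N D N) (a b : ℕ) : ¬ Cand R D a b := by
  rcases h with h | h
  · exact h a b
  · have := Finset.card_filter_le (Finset.range N) fun x => D x = 1
    rw [Finset.card_range] at this
    omega

theorem Progress.step {N r e f : ℕ} (h : Progress R N D r) (hc : Cand R D e f) (he : e < N) :
    Progress R N (Function.update D e 1) (r + 1) := by
  rcases h with h | h
  · exact absurd hc (h e f)
  · refine .inr (lt_of_lt_of_le (Nat.succ_lt_succ h) ?_)
    rw [Nat.succ_le_iff]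
    refine Finset.card_lt_card (Finset.ssubset_iff_of_subset ?_ |>.2 ⟨e, by simp [he], ?_⟩)
    · intro x hx
      simp only [Finset.mem_filter, Finset.mem_range] at hx ⊢
      refine ⟨hx.1, ?_⟩
      rw [Function.update_of_ne, hx.2]
      rintro rfl
      exact hc.1 hx.2
    · simp [hc.1]

end ShortestPath

/-! ### The program -/

namespace TrailProgram

open RAM ShortestPath

/-- Record the pair held by registers `11` and `12` as the best one, with its cost. -/
def record : Prog :=
  .seq (.op (.wmove 0 1)) (.seq (.op (.move 14 11)) (.seq (.op (.move 15 12)) (.op (.const 13 1))))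

/-- Compare the pair held by registers `11` and `12` with the best pair found before. -/
def compare : Prog :=
  .seq (.op (.wread 1 0 11)) (.seq (.op (.wread 2 1 12)) (.seq (.op (.wadd 1 1 2))
    (.ite (.eq 13 6) (.ite (.wlt 1 0) record (.op .skip)) record)))

/-- Test whether the pair held by registers `11` and `12` is an arc into the settled nodes, and if
so, compare it with the best pair found before. -/
def inspect : Prog :=
  .seq (.op (.read 16 3 11)) (.seq (.op (.read 17 3 12)) (.seq (.op (.read 18 1 11))
    (.seq (.op (.read 19 0 12)) (.seq (.op (.read 20 2 11)) (.seq (.op (.read 21 2 12))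
      (.ite (.eq 16 6) (.op .skip) (.ite (.eq 17 6) (.ite (.eq 18 19)
        (.ite (.eq 20 21) (.op .skip) compare) (.op .skip)) (.op .skip))))))))

/-- Inspect all pairs with a given first component. -/
def scanRow : Prog :=
  .seq (.op (.const 12 0)) (.seq (.loop (.lt 12 9) (.seq inspect (.op (.add 12 12 6))))
    (.op (.add 11 11 6)))

/-- Inspect all pairs. -/
def scan : Prog :=
  .seq (.seq (.op (.const 13 0)) (.op (.const 11 0))) (.loop (.lt 11 9) scanRow)

/-- Settle the best node, if there is one. -/
def settle : Prog :=
  .seq (.ite (.eq 13 6)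
    (.seq (.op (.write 3 14 6)) (.seq (.op (.wwrite 1 14 0)) (.op (.write 4 14 15)))) (.op .skip))
    (.op (.add 10 10 6))

/-- Create an arc `m` out of `t` and an arc `m + 1` into `s`, in the extra color `c`. -/
def setup : Prog :=
  .seq (.op (.const 6 1)) (.seq (.op (.move 7 1)) (.seq (.op (.add 8 1 6)) (.seq (.op (.add 9 8 6))
    (.seq (.op (.write 0 7 4)) (.seq (.op (.write 1 8 3)) (.seq (.op (.write 2 7 2))
      (.seq (.op (.write 2 8 2)) (.op (.write 3 7 6)))))))))

/-- Follow the successors from the arc `m + 1` and write them to the array `0`. -/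
def trace : Prog :=
  .seq (.seq (.op (.const 0 1)) (.seq (.op (.const 1 0)) (.op (.read 22 4 8))))
    (.loop (.lt 22 7)
      (.seq (.op (.write 0 1 22)) (.seq (.op (.add 1 1 6)) (.op (.read 22 4 22)))))

/-- Dijkstra's algorithm on the arcs, backwards from `t`. -/
def main : Prog :=
  .seq setup (.seq (.loop (.lt 10 9) (.seq scan settle))
    (.seq (.op (.read 16 3 8)) (.ite (.eq 16 6) trace (.op (.const 0 0)))))

/-! ### Invariants of the search for a cheapest arc into the settled set -/

/-- The contents of the arrays `0`, `1`, `2` and of the weight array `0` after the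
initialization. -/
structure Net where
  m : ℕ
  tl : ℕ → ℕ
  hd : ℕ → ℕ
  cl : ℕ → ℕ
  w : ℕ → ℝ≥0

/-- The arcs `x` and `y` can be consecutive on a trail. -/
def Net.Rel (N : Net) (x y : ℕ) : Prop :=
  x < N.m + 2 ∧ y < N.m + 2 ∧ N.hd x = N.tl y ∧ N.cl x ≠ N.cl y

/-- The part of the memory that is used by all rounds. -/
structure Mem (N : Net) (D : ℕ → ℕ) (d : ℕ → ℝ≥0) (nx : ℕ → ℕ) (σ : State) : Prop where
  one : σ.reg 6 = 1
  m : σ.reg 7 = N.m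
  src : σ.reg 8 = N.m + 1
  size : σ.reg 9 = N.m + 2
  tl : σ.arr 0 = N.tl
  hd : σ.arr 1 = N.hd
  cl : σ.arr 2 = N.cl
  w : σ.warr 0 = N.w
  done : σ.arr 3 = D
  dist : σ.warr 1 = d
  next : σ.arr 4 = nx

variable {N : Net} {D : ℕ → ℕ} {d : ℕ → ℝ≥0} {nx : ℕ → ℕ}

theorem Mem.of_eq {σ τ : State} (hm : Mem N D d nx σ) (h6 : τ.reg 6 = σ.reg 6)
    (h7 : τ.reg 7 = σ.reg 7) (h8 : τ.reg 8 = σ.reg 8) (h9 : τ.reg 9 = σ.reg 9)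
    (ha : τ.arr = σ.arr) (hw : τ.warr = σ.warr) : Mem N D d nx τ :=
  ⟨h6.trans hm.one, h7.trans hm.m, h8.trans hm.src, h9.trans hm.size, ha ▸ hm.tl,
    ha ▸ hm.hd, ha ▸ hm.cl, hw ▸ hm.w, ha ▸ hm.done, hw ▸ hm.dist, ha ▸ hm.next⟩

/-- The registers describe a best candidate among the pairs in `S`. -/
def Best (N : Net) (D : ℕ → ℕ) (d : ℕ → ℝ≥0) (S : ℕ → ℕ → Prop) (σ : State) : Prop :=
  (σ.reg 13 = 0 ∧ ∀ x y, S x y → ¬ Cand N.Rel D x y) ∨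
  (σ.reg 13 = 1 ∧ Cand N.Rel D (σ.reg 14) (σ.reg 15) ∧
    σ.wreg 0 = N.w (σ.reg 14) + d (σ.reg 15) ∧
    ∀ x y, S x y → Cand N.Rel D x y → σ.wreg 0 ≤ N.w x + d y)

theorem Best.congr {S S' : ℕ → ℕ → Prop} {σ τ : State} (h : Best N D d S σ)
    (h₁ : τ.reg 13 = σ.reg 13) (h₂ : τ.reg 14 = σ.reg 14) (h₃ : τ.reg 15 = σ.reg 15)
    (h₄ : τ.wreg 0 = σ.wreg 0) (hS : ∀ x y, S' x y → Cand N.Rel D x y → S x y) :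
    Best N D d S' τ := by
  unfold Best
  rw [h₁, h₂, h₃, h₄]
  rcases h with ⟨h, h'⟩ | ⟨h, hc, hw, h'⟩
  · exact .inl ⟨h, fun x y hS' hc => h' x y (hS x y hS' hc) hc⟩
  · exact .inr ⟨h, hc, hw, fun x y hS' hc => h' x y (hS x y hS' hc) hc⟩

/-- The pairs that precede `(e, f)` in the order of inspection. -/
def Before (M e f x y : ℕ) : Prop := x < e ∧ y < M ∨ x = e ∧ y < f

theorem before_succ {M e f x y : ℕ} :
    Before M e (f + 1) x y ↔ Before M e f x y ∨ x = e ∧ y = f := by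
  unfold Before
  omega

theorem Best.skip {e f : ℕ} {σ τ : State} (h : Best N D d (Before (N.m + 2) e f) σ)
    (hc : ¬ Cand N.Rel D e f) (h₁ : τ.reg 13 = σ.reg 13) (h₂ : τ.reg 14 = σ.reg 14)
    (h₃ : τ.reg 15 = σ.reg 15) (h₄ : τ.wreg 0 = σ.wreg 0) :
    Best N D d (Before (N.m + 2) e (f + 1)) τ := by
  refine h.congr h₁ h₂ h₃ h₄ fun x y hS hxy => ?_
  rcases before_succ.1 hS with hS | ⟨rfl, rfl⟩
  · exact hS
  · exact absurd hxy hc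

theorem Best.keep {e f : ℕ} {σ τ : State} (h : Best N D d (Before (N.m + 2) e f) σ)
    (h13 : σ.reg 13 = 1) (hw : σ.wreg 0 ≤ N.w e + d f) (h₁ : τ.reg 13 = σ.reg 13)
    (h₂ : τ.reg 14 = σ.reg 14) (h₃ : τ.reg 15 = σ.reg 15) (h₄ : τ.wreg 0 = σ.wreg 0) :
    Best N D d (Before (N.m + 2) e (f + 1)) τ := by
  unfold Best
  rw [h₁, h₂, h₃, h₄]
  rcases h with ⟨h, -⟩ | ⟨h, hc, hw', h'⟩
  · omega
  · refine .inr ⟨h, hc, hw', fun x y hS hxy => ?_⟩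
    rcases before_succ.1 hS with hS | ⟨rfl, rfl⟩
    · exact h' x y hS hxy
    · exact hw

theorem Best.replace {e f : ℕ} {σ τ : State} (h : Best N D d (Before (N.m + 2) e f) σ)
    (hc : Cand N.Rel D e f) (hw : σ.reg 13 = 1 → N.w e + d f ≤ σ.wreg 0) (h₁ : τ.reg 13 = 1)
    (h₂ : τ.reg 14 = e) (h₃ : τ.reg 15 = f) (h₄ : τ.wreg 0 = N.w e + d f) :
    Best N D d (Before (N.m + 2) e (f + 1)) τ := by
  unfold Best
  rw [h₁, h₂, h₃, h₄]
  refine .inr ⟨rfl, hc, rfl, fun x y hS hxy => ?_⟩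
  rcases before_succ.1 hS with hS | ⟨rfl, rfl⟩
  · rcases h with ⟨h, h'⟩ | ⟨h, -, -, h'⟩
    · exact absurd hxy (h' x y hS)
    · exact (hw h).trans (h' x y hS hxy)
  · exact le_rfl

/-- In round `r`, the pairs in `S` have been inspected. -/
structure Scan (N : Net) (D : ℕ → ℕ) (d : ℕ → ℝ≥0) (nx : ℕ → ℕ) (r : ℕ) (S : ℕ → ℕ → Prop)
    (σ : State) : Prop where
  mem : Mem N D d nx σ
  round : σ.reg 10 = r
  best : Best N D d S σ

/-- The loop invariant for the pairs with first component `e`. -/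
def InRow (N : Net) (D : ℕ → ℕ) (d : ℕ → ℝ≥0) (nx : ℕ → ℕ) (r e f : ℕ) (σ : State) : Prop :=
  Scan N D d nx r (Before (N.m + 2) e f) σ ∧ σ.reg 11 = e ∧ σ.reg 12 = f

/-- The loop invariant for the first component. -/
def AtRow (N : Net) (D : ℕ → ℕ) (d : ℕ → ℝ≥0) (nx : ℕ → ℕ) (r e : ℕ) (σ : State) : Prop :=
  Scan N D d nx r (Before (N.m + 2) e 0) σ ∧ σ.reg 11 = e

theorem inspect_spec {e f r : ℕ} {σ : State} (he : e < N.m + 2) (hf : f < N.m + 2)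
    (h : InRow N D d nx r e f σ) :
    wp (.seq inspect (.op (.add 12 12 6))) (InRow N D d nx r e (f + 1)) σ := by
  obtain ⟨⟨hm, h10, hb⟩, h11, h12⟩ := h
  simp only [wp, inspect, compare, record, Op.exec, Test.Holds]
  simp only [Function.update_apply, Nat.reduceEqDiff, OfNat.ofNat_ne_one, OfNat.zero_ne_ofNat,
    OfNat.one_ne_ofNat, zero_ne_one,
    if_true, if_false, hm.one, hm.tl, hm.hd, hm.cl, hm.w, hm.done, hm.dist, h11, h12]
  have hc : Cand N.Rel D e f ↔ D e ≠ 1 ∧ D f = 1 ∧ N.hd e = N.tl f ∧ N.cl e ≠ N.cl f := by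
    simp [Cand, Net.Rel, he, hf]
  refine ⟨fun h1 => ?_, fun h1 => ⟨fun h2 => ⟨fun h3 => ⟨fun h4 => ?_, fun h4 => ⟨fun h5 =>
    ⟨fun h6 => ?_, fun h6 => ?_⟩, fun h5 => ?_⟩⟩, fun h3 => ?_⟩, fun h2 => ?_⟩⟩
  -- The goals are the exits of the nested tests, in order: e settled, equal colors, cheaper pair,
  -- no improvement, first candidate found, ends not matching, f not settled.
  all_goals refine ⟨⟨hm.of_eq rfl rfl rfl rfl rfl rfl, h10, ?_⟩, h11, rfl⟩
  · exact hb.skip (by tauto) rfl rfl rfl rfl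
  · exact hb.skip (by tauto) rfl rfl rfl rfl
  · exact hb.replace (by tauto) (fun _ => h6.le) rfl rfl rfl rfl
  · exact hb.keep h5 (not_lt.1 h6) rfl rfl rfl rfl
  · exact hb.replace (by tauto) (fun h => absurd h h5) rfl rfl rfl rfl
  · exact hb.skip (by tauto) rfl rfl rfl rfl
  · exact hb.skip (by tauto) rfl rfl rfl rfl

/-- The number of steps for the inspection of one pair. -/
def pairTime : ℕ := (Prog.seq inspect (.op (.add 12 12 6))).time

theorem scanRow_spec {e r : ℕ} {σ : State} (he : e < N.m + 2) (h : AtRow N D d nx r e σ) :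
    Ensures scanRow (1 + ((N.m + 2) * (pairTime + 1) + 1 + 1)) σ (AtRow N D d nx r (e + 1)) := by
  obtain ⟨⟨hm, h10, hb⟩, h11⟩ := h
  have h₀ : Ensures (.op (.const 12 0)) 1 σ (InRow N D d nx r e 0) :=
    ensures_of_wp ⟨⟨hm.of_eq rfl rfl rfl rfl rfl rfl, h10,
      hb.congr rfl rfl rfl rfl fun _ _ h _ => h⟩, h11, rfl⟩
  refine h₀.seq fun τ hτ => (Ensures.loop (InRow N D d nx r e) (fun i σ h => ?_)
    (fun i σ hi h => ensures_of_wp (inspect_spec he hi h)) hτ).seq fun υ hυ => ?_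
  · simp [Test.Holds, h.2.2, h.1.mem.size]
  · obtain ⟨⟨hm, h10, hb⟩, h11, h12⟩ := hυ
    refine ensures_of_wp (P := .op _) ⟨⟨hm.of_eq rfl rfl rfl rfl rfl rfl, h10,
      hb.congr rfl rfl rfl rfl ?_⟩, by simp [Op.exec, h11, hm.one]⟩
    -- The end of row e is the start of row e + 1 in the order of inspection.
    intro x y h _
    unfold Before at *
    omega

/-- `Net.Rel` bounds both its arguments by m + 2, so the pairs scanned include all arcs of the line
digraph. -/
theorem scan_spec {r : ℕ} {σ : State} (hm : Mem N D d nx σ) (h10 : σ.reg 10 = r) :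
    Ensures scan (2 + ((N.m + 2) * (1 + ((N.m + 2) * (pairTime + 1) + 1 + 1) + 1) + 1)) σ
      (Scan N D d nx r N.Rel) := by
  have h₀ : Ensures (.seq (.op (.const 13 0)) (.op (.const 11 0))) 2 σ (AtRow N D d nx r 0) :=
    ensures_of_wp ⟨⟨hm.of_eq rfl rfl rfl rfl rfl rfl, h10, .inl ⟨rfl, by simp [Before]⟩⟩, rfl⟩
  refine h₀.seq fun τ hτ => (Ensures.loop (AtRow N D d nx r) (fun i σ h => ?_)
    (fun i σ hi h => scanRow_spec hi h) hτ).mono fun υ hυ => ?_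
  · simp [Test.Holds, h.2, h.1.mem.size]
  · obtain ⟨⟨hm, h10, hb⟩, h11⟩ := hυ
    exact ⟨hm, h10, hb.congr rfl rfl rfl rfl fun x y h _ => .inl ⟨h.1, h.2.1⟩⟩

/-! ### Rounds of Dijkstra's algorithm and reading off the path -/

/-- The memory after `r` rounds. -/
def Round (N : Net) (r : ℕ) (σ : State) : Prop :=
  ∃ D d nx, Mem N D d nx σ ∧ σ.reg 10 = r ∧ Settled N.Rel N.w N.m D d nx ∧
    Progress N.Rel (N.m + 2) D r

theorem settle_spec {r : ℕ} {σ : State} (h : Scan N D d nx r N.Rel σ)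
    (hs : Settled N.Rel N.w N.m D d nx) (hp : Progress N.Rel (N.m + 2) D r) :
    wp settle (Round N (r + 1)) σ := by
  obtain ⟨hm, h10, hb⟩ := h
  simp only [wp, settle, Op.exec, Test.Holds]
  refine ⟨fun h13 => ?_, fun h13 => ?_⟩
  · rw [hm.one] at h13
    rcases hb with ⟨h, -⟩ | ⟨-, hc, hw, hmin⟩
    · omega
    rw [hw] at hmin
    refine ⟨_, _, _, ⟨hm.one, hm.m, hm.src, hm.size, hm.tl, hm.hd, hm.cl, hm.w, ?_, ?_, ?_⟩, ?_,
      hs.step hc fun a b hab => hmin a b hab.2.2 hab, hp.step hc hc.2.2.1⟩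
    · simp [hm.done, hm.one]
    · simp [hm.dist, hw]
    · simp [hm.next]
    · simp [h10, hm.one]
  · rw [hm.one] at h13
    rcases hb with ⟨-, h⟩ | ⟨h, -⟩
    · exact ⟨D, d, nx, hm.of_eq rfl rfl rfl rfl rfl rfl, by simp [h10, hm.one], hs,
        .inl fun a b hab => h a b hab.2.2 hab⟩
    · exact absurd h h13

theorem trace_spec {σ : State} (hm : Mem N D d nx σ) {q : List ℕ} (hq : ∀ x ∈ q, x < N.m)
    (hc : ((N.m + 1) :: (q ++ [N.m])).IsChain fun a b => nx a = b) :
    Ensures trace (3 + (q.length * (3 + 1) + 1)) σ fun τ =>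
      τ.reg 0 = 1 ∧ τ.reg 1 = q.length ∧ ∀ (i : ℕ) (h : i < q.length), τ.arr 0 i = q[i] := by
  let I : ℕ → State → Prop := fun i τ => τ.reg 6 = 1 ∧ τ.reg 7 = N.m ∧ τ.arr 4 = nx ∧
    τ.reg 0 = 1 ∧ τ.reg 1 = i ∧ (q ++ [N.m])[i]? = some (τ.reg 22) ∧
    ∀ (j : ℕ) (h : j < q.length), j < i → τ.arr 0 j = q[j]
  have h₀ : Ensures (.seq (.op (.const 0 1)) (.seq (.op (.const 1 0)) (.op (.read 22 4 8)))) 3 σ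
      (I 0) := by
    refine ensures_of_wp ⟨hm.one, hm.m, hm.next, rfl, rfl, ?_, by simp⟩
    have : (q ++ [N.m])[0]? = some (nx (N.m + 1)) := by
      clear_value I
      cases q <;> simp_all
    simpa [Op.exec, hm.next, hm.src] using this
  refine h₀.seq fun τ hτ => (Ensures.loop I (fun i σ h => ?_) (fun i σ hi h => ?_) hτ).mono
    fun υ hυ => ?_
  -- The entries of q are below m and the node after them is m itself, so the test register < m
  -- fails exactly at the end of q.
  · obtain ⟨-, h7, -, -, -, h22, -⟩ := h
    simp only [Test.Holds, h7]
    obtain ⟨hi, h22⟩ := List.getElem?_eq_some_iff.1 h22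
    rw [← h22, List.getElem_append]
    split
    · next h => simpa [h] using hq _ (List.getElem_mem h)
    · next h => simpa using h
  · obtain ⟨h6, h7, h4, h0, h1, h22, hj⟩ := h
    refine ensures_of_wp ⟨h6, h7, ?_, h0, ?_, ?_, fun j h hji => ?_⟩
    · simpa [Op.exec] using h4
    · simp [Op.exec, h1, h6]
    · rw [List.isChain_iff_getElem] at hc
      have := hc (i + 1) (by simp; omega)
      obtain ⟨hi', h22⟩ := List.getElem?_eq_some_iff.1 h22
      simp only [List.getElem_cons_succ, h22] at this
      rw [List.getElem?_eq_getElem (by simp; omega)]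
      simp [Op.exec, h4, ← this]
    · by_cases hji' : j = i
      · subst hji'
        simp only [List.getElem?_append_left h, List.getElem?_eq_getElem h, Option.some.injEq]
          at h22
        simp [Op.exec, h1, h22]
      · have := hj j h (by omega)
        simp [Op.exec, h1, hji', this]
  · exact ⟨hυ.2.2.2.1, hυ.2.2.2.2.1, fun i h => hυ.2.2.2.2.2.2 i h h⟩

/-! ### Running time and correctness of the program -/

/-- A bound for the running time of the program on `M` arcs. -/
def bound (M : ℕ) : ℕ :=
  9 + (((M + 2) * ((2 + ((M + 2) * (1 + ((M + 2) * (pairTime + 1) + 1 + 1) + 1) + 1) +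
    settle.time) + 1) + 1) + (1 + ((3 + (M * (3 + 1) + 1)) + 1)))

theorem exists_polynomial_eval_eq_bound : ∃ p : Polynomial ℕ, ∀ M, p.eval M = bound M :=
  ⟨9 + (((.X + 2) * ((2 + ((.X + 2) * (1 + ((.X + 2) * ((pairTime : Polynomial ℕ) + 1) + 1 + 1) +
    1) + 1) + (settle.time : Polynomial ℕ)) + 1) + 1) + (1 + ((3 + (.X * (3 + 1) + 1)) + 1))),
    fun M => by simp [bound]⟩

theorem bound_mono {M M' : ℕ} (h : M ≤ M') : bound M ≤ bound M' := by
  unfold bound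
  gcongr

/-- The arcs `q` form a shortest trail that is bounded by the two additional arcs. -/
structure IsShortest (N : Net) (q : List ℕ) : Prop where
  lt : ∀ x ∈ q, x < N.m
  nodup : q.Nodup
  chain : ((N.m + 1) :: (q ++ [N.m])).IsChain N.Rel
  le : ∀ W, Walk N.Rel N.w N.m (N.m + 1) W → (q.map N.w).sum ≤ W

/-- The pointer path from `m + 1` to `m` has no repetitions, so its interior q avoids both extra
nodes. This matters because the unset head of `m` and tail of `m + 1` are 0 in memory, which may
create spurious arcs out of `m` and into `m + 1`. -/
theorem exists_isShortest (hw : N.w N.m = 0) (hw' : N.w (N.m + 1) = 0)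
    (hs : Settled N.Rel N.w N.m D d nx) (hD : D (N.m + 1) = 1) :
    ∃ q, IsShortest N q ∧ ((N.m + 1) :: (q ++ [N.m])).IsChain fun a b => nx a = b := by
  obtain ⟨p, h₁, h₂, h₃, -, h₅⟩ := hs.path _ hD
  have hp : p ≠ [] := by
    rintro rfl
    simp at h₃
  obtain ⟨q, z, rfl⟩ := (List.eq_nil_or_concat' p).resolve_left hp
  obtain rfl : z = N.m := by
    rw [← List.cons_append, List.getLast?_append] at h₃
    simpa using h₃
  have hR := h₂.imp fun a b h => h.1
  rw [List.nodup_cons, List.nodup_append, List.mem_append] at h₁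
  refine ⟨q, ⟨fun x hx => ?_, h₁.2.1, hR, fun W hW => ?_⟩, h₂.imp fun a b h => h.2⟩
  · have hne : x ≠ N.m + 1 := by
      rintro rfl
      exact h₁.1 (.inl hx)
    have hne' : x ≠ N.m := h₁.2.2.2 x hx _ (by simp)
    have : x < N.m + 2 := by
      obtain ⟨i, hi, rfl⟩ := List.getElem_of_mem hx
      have := ((List.isChain_iff_getElem.1 hR) i (by simp; omega)).2.1
      simpa [List.getElem_append_left hi] using this
    omega
  · refine le_trans (le_of_eq ?_) (hs.opt _ W hD hW)
    simp [h₅, hw, hw']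

/-- The final memory of the program. -/
def Result (N : Net) (τ : State) : Prop :=
  (τ.reg 0 = 1 ∧ ∃ q, IsShortest N q ∧ τ.reg 1 = q.length ∧
    ∀ (i : ℕ) (h : i < q.length), τ.arr 0 i = q[i]) ∨
  (τ.reg 0 = 0 ∧ ∀ W, ¬ Walk N.Rel N.w N.m (N.m + 1) W)

theorem IsShortest.length_le {q : List ℕ} (h : IsShortest N q) : q.length ≤ N.m := by
  have := (List.toFinset_card_of_nodup h.nodup).symm.trans_le
    (Finset.card_le_card (t := Finset.range N.m) fun x hx => by simpa using h.lt x (by simpa using hx))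
  simpa using this

theorem main_spec {σ : State} (hw : N.w N.m = 0) (hw' : N.w (N.m + 1) = 0)
    (h : wp setup (Round N 0) σ) : Ensures main (bound N.m) σ (Result N) := by
  refine (ensures_of_wp h).seq fun τ hτ => (Ensures.loop (N := N.m + 2) (Round N)
    (fun i σ h => ?_) (fun i σ hi h => ?_) hτ).seq fun υ hυ => ?_
  · obtain ⟨D, d, nx, hm, h10, -⟩ := h
    simp [Test.Holds, h10, hm.size]
  · obtain ⟨D, d, nx, hm, h10, hs, hp⟩ := h
    exact (scan_spec hm h10).seq fun τ hτ => ensures_of_wp (settle_spec hτ hs hp)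
  · obtain ⟨D, d, nx, hm, -, hs, hp⟩ := hυ
    have h₀ : Ensures (.op (.read 16 3 8)) 1 υ fun τ => Mem N D d nx τ ∧ τ.reg 16 = D (N.m + 1) :=
      ensures_of_wp ⟨hm.of_eq rfl rfl rfl rfl rfl rfl, by simp [Op.exec, hm.done, hm.src]⟩
    refine h₀.seq fun φ hφ => Ensures.ite (fun hb => ?_) (fun hb => ?_)
    · simp only [Test.Holds, hφ.2, hφ.1.one] at hb
      obtain ⟨q, hq, hc⟩ := exists_isShortest hw hw' hs hb
      obtain ⟨k, ψ, hr, hk, h0, h1, ha⟩ := trace_spec hφ.1 hq.lt hc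
      refine ⟨k, ψ, hr, hk.trans ?_, .inl ⟨h0, q, hq, h1, ha⟩⟩
      have := hq.length_le
      gcongr
    · simp only [Test.Holds, hφ.2, hφ.1.one] at hb
      refine ⟨1, _, .op _ _, by omega, .inr ⟨rfl, fun W hW => ?_⟩⟩
      -- A walk from the unsettled node `m + 1` would leave a candidate, but none remains after the
      -- last round.
      obtain ⟨a, b, hab, -⟩ := hs.exists_cand hW hb
      exact hp.not_cand a b hab

end TrailProgram

/-! ### Trails as paths in the line digraph -/

namespace ColoredDigraph

open RAM ShortestPath TrailProgram

variable {n m c : ℕ} (G : ColoredDigraph (Fin n) c) (arc : Fin m ≃ G.Arc) (s t : Fin n)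

/-- The memory after the initialization, for the given input. -/
noncomputable def net : Net where
  m := m
  tl := Function.update ((G.inputState arc s t).arr 0) m t
  hd := Function.update ((G.inputState arc s t).arr 1) (m + 1) s
  cl := Function.update (Function.update ((G.inputState arc s t).arr 2) m c) (m + 1) c
  w := (G.inputState arc s t).warr 0

theorem wp_setup : wp setup (Round (G.net arc s t) 0) (G.inputState arc s t) := by
  have hset : Settled (G.net arc s t).Rel (G.net arc s t).w m (Function.update (fun _ => 0) m 1)
      (fun _ => 0) (fun _ => 0) :=
    settled_init (by simp [net, inputState]) (by simp)
      (fun x hx => by by_contra hne; simp [hne] at hx) rfl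
  have hp : Progress (G.net arc s t).Rel (m + 2) (Function.update (fun _ => 0) m 1) 0 :=
    .inr (Finset.card_pos.2 ⟨m, by simp⟩)
  refine ⟨_, _, _, ⟨rfl, rfl, rfl, rfl, ?_, ?_, ?_, ?_, ?_, ?_, ?_⟩, rfl, hset, hp⟩
  all_goals simp [Op.exec, net, inputState]

variable {G arc s t}

theorem net_head (i : Fin m) : (G.net arc s t).hd i = (arc i).head := by
  simp [net, inputState, (i.2.trans (Nat.lt_succ_self m)).ne]

theorem net_tail (i : Fin m) : (G.net arc s t).tl i = (arc i).tail := by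
  simp [net, inputState, i.2.ne]

theorem net_color (i : Fin m) : (G.net arc s t).cl i = G.color (arc i) := by
  simp [net, inputState, i.2.ne, (i.2.trans (Nat.lt_succ_self m)).ne]

theorem net_weight (i : Fin m) : (G.net arc s t).w i = G.weight (arc i) := by
  simp [net, inputState]

theorem net_rel {i j : Fin m} : (G.net arc s t).Rel i j ↔
    (arc i).head = (arc j).tail ∧ G.color (arc i) ≠ G.color (arc j) := by
  have hi : (i : ℕ) < m + 2 := by omega
  have hj : (j : ℕ) < m + 2 := by omega
  simp only [Net.Rel, net_head, net_tail, net_color, ne_eq, Fin.val_inj]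
  simp [net, hi, hj]

theorem net_rel_target {i : Fin m} : (G.net arc s t).Rel i m ↔ (arc i).head = t := by
  have hi : (i : ℕ) < m + 2 := by omega
  have ht : (G.net arc s t).tl m = t := by simp [net]
  have hc : (G.net arc s t).cl m = c := by simp [net]
  simp only [Net.Rel, net_head, net_color, ht, hc, ne_eq, Fin.val_inj]
  simp [net, hi, (G.color (arc i)).2.ne]

theorem net_rel_source {i : Fin m} : (G.net arc s t).Rel (m + 1) i ↔ (arc i).tail = s := by
  have hi : (i : ℕ) < m + 2 := by omega
  have hs : (G.net arc s t).hd (m + 1) = s := by simp [net]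
  have hc : (G.net arc s t).cl (m + 1) = c := by simp [net]
  simp only [Net.Rel, net_tail, net_color, hs, hc, ne_eq, Fin.val_inj]
  simp [net, hi, (G.color (arc i)).2.ne', eq_comm]

/-- Both extra arcs have color c; hence a path between them contains an input arc, even when s = t.
-/
theorem not_net_rel_source_target : ¬ (G.net arc s t).Rel (m + 1) m := by
  simp [Net.Rel, net]

theorem walk_of_chain {l : List (Fin m)} {i : Fin m}
    (h : ((i :: l).map arc).IsChain fun e f => e.head = f.tail)
    (h' : ((i :: l).map arc).IsChain fun e f => G.color e ≠ G.color f)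
    (hl : ∀ e ∈ ((i :: l).map arc).getLast?, e.head = t) :
    Walk (G.net arc s t).Rel (G.net arc s t).w m i (G.trailWeight ((i :: l).map arc)) := by
  induction l generalizing i with
  | nil =>
    have := Walk.cons (R := (G.net arc s t).Rel) (w := (G.net arc s t).w) 
      (net_rel_target.2 (hl (arc i) (by simp))) .nil
    simpa [net_weight, trailWeight] using this
  | cons j l ih =>
    simp only [List.map_cons, List.isChain_cons_cons, List.getLast?_cons_cons] at h h' hl
    have := Walk.cons (net_rel.2 ⟨h.1, h'.1⟩) (ih (i := j) h.2 h'.2 hl)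
    simpa [net_weight, trailWeight] using this

/-- This makes every trail a competitor in `IsShortest.le`; the extra arcs add no weight. -/
theorem IsPCFEVTrail.walk {T : List G.Arc} (hT : G.IsPCFEVTrail s t T) :
    Walk (G.net arc s t).Rel (G.net arc s t).w m (m + 1) (G.trailWeight T) := by
  obtain ⟨l, rfl⟩ : ∃ l : List (Fin m), l.map arc = T := ⟨T.map arc.symm, by simp⟩
  match l, hT with
  | [], hT => exact absurd rfl hT.ne_nil
  | i :: l, hT =>
    have := Walk.cons (net_rel_source.2 (hT.start (arc i) (by simp)))
      (walk_of_chain hT.chain hT.proper hT.finish)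
    simpa [net, inputState] using this

theorem isPCFEVTrail_of_isShortest {l : List (Fin m)}
    (h : IsShortest (G.net arc s t) (l.map Fin.val)) : G.IsPCFEVTrail s t (l.map arc) := by
  obtain ⟨-, hn, hc, -⟩ := h
  have hne : l ≠ [] := by
    rintro rfl
    exact not_net_rel_source_target (List.isChain_cons_cons.1 hc).1
  have hc' := (List.isChain_append.1 hc.tail)
  have hch : l.IsChain fun i j => (arc i).head = (arc j).tail ∧ G.color (arc i) ≠ G.color (arc j) :=
    ((List.isChain_map _).1 hc'.1).imp fun i j h => net_rel.1 h
  refine ⟨⟨by simpa using hne, fun e he => ?_, fun e he => ?_, ?_, ?_⟩, ?_⟩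
  · cases l with
    | nil => exact absurd rfl hne
    | cons i l =>
      obtain rfl : arc i = e := by simpa using he
      exact net_rel_source.1 (List.isChain_cons_cons.1 hc).1
  · rw [List.getLast?_map] at he
    obtain ⟨i, hi, rfl⟩ := Option.mem_map.1 he
    exact net_rel_target.1 (hc'.2.2 i (by rw [List.getLast?_map]; exact Option.mem_map_of_mem _ hi)
      m (by simp [net]))
  · exact (List.isChain_map _).2 (hch.imp fun i j h => h.1)
  -- Distinct nodes of the path are distinct arcs, which is the trail condition.
  · exact (hn.of_map _).map arc.injective
  · exact (List.isChain_map _).2 (hch.imp fun i j h => h.2)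

theorem isMinPCFEVTrail_of_isShortest {l : List (Fin m)}
    (h : IsShortest (G.net arc s t) (l.map Fin.val)) : G.IsMinPCFEVTrail s t (l.map arc) := by
  refine ⟨isPCFEVTrail_of_isShortest h, fun T' hT' => ?_⟩
  have := h.le _ hT'.walk
  rw [List.map_map] at this
  rw [trailWeight, List.map_map]
  have hw : G.weight ∘ arc = (G.net arc s t).w ∘ Fin.val := by
    ext i
    simp [net_weight]
  rwa [hw]

end ColoredDigraph

theorem mainTheorem4 :
    ∃ (P : RAM.Prog) (p : Polynomial ℕ),
      ∀ (c : ℕ), 2 ≤ c → ∀ (n m : ℕ) (G : ColoredDigraph (Fin n) c) (arc : Fin m ≃ G.Arc)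
        (s t : Fin n),
        ∃ (k : ℕ) (σ : RAM.State),
          RAM.Run P (G.inputState arc s t) k σ ∧ k ≤ p.eval (n + m) ∧
          ((∃ T, G.IsPCFEVTrail s t T) →
            σ.reg 0 = 1 ∧ ∃ T, G.IsMinPCFEVTrail s t T ∧ G.Outputs arc σ T) ∧
          ((¬ ∃ T, G.IsPCFEVTrail s t T) → σ.reg 0 = 0) := by
  obtain ⟨p, hp⟩ := TrailProgram.exists_polynomial_eval_eq_bound
  refine ⟨TrailProgram.main, p, fun c _ n m G arc s t => ?_⟩
  obtain ⟨k, σ, hr, hk, hres⟩ := TrailProgram.main_spec (N := G.net arc s t)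
    (by simp [ColoredDigraph.net, ColoredDigraph.inputState])
    (by simp [ColoredDigraph.net, ColoredDigraph.inputState]) (G.wp_setup arc s t)
  refine ⟨k, σ, hr, hk.trans ?_, ?_⟩
  · rw [hp]
    exact TrailProgram.bound_mono (Nat.le_add_left m n)
  rcases hres with ⟨h0, q, hq, h1, ha⟩ | ⟨h0, hW⟩
  · have hlt : ∀ x ∈ q, x < m := hq.lt
    -- All entries of q are below m, so q consists of positions of input arcs.
    obtain ⟨l, rfl⟩ : ∃ l : List (Fin m), l.map Fin.val = q :=
      ⟨q.pmap Fin.mk hlt, by simp [List.map_pmap]⟩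
    have hmin := ColoredDigraph.isMinPCFEVTrail_of_isShortest hq
    exact ⟨fun _ => ⟨h0, l.map arc, hmin, by simpa using h1,
      fun i h => (ha i (by simpa using h)).trans (by simp)⟩, fun h => absurd ⟨_, hmin.1⟩ h⟩
  · exact ⟨fun ⟨T, hT⟩ => absurd hT.walk (hW _), fun _ => h0⟩
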